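/- Let $\mathbb{F}_2^n$ denote the $n$-dimensional vector space over the field with two elements. For a random variable $\mathbf{X}$ over a finite set, its min-entropy is $H_\infty(\mathbf{X}) = \min_{x \in \mathrm{supp}(\mathbf{X})} \log_2(1/\Pr[\mathbf{X}=x])$. An $(n,k)$-sumset source is a random variable $\mathbf{X}=\mathbf{A}+\mathbf{B}$, where $\mathbf{A},\mathbf{B}$ are independent random variables over $\mathbb{F}_2^n$ with $H_\infty(\mathbf{A}), H_\infty(\mathbf{B}) \ge k$. A function $f:\mathbb{F}_2^n\to\mathbb{F}_2$ is an $\varepsilon$-extractor for $(n,k)$-sumset sources if, for every $(n,k)$-sumset source $\mathbf{X}$, the statistical distance $\frac12\sum_{b\in\mathbb{F}_2}\left|\Pr[f(\mathbf{X})=b]-\frac12\right|$ between $f(\mathbf{X})$ and a uniform bit is at most $\varepsilon$. A random degree $d$ polynomial is $f(x)=\sum_{S\subseteq[n],\,|S|\le d}\alpha_S\prod_{i\in S}x_i$, where the coefficients $\alpha_S\in\mathbb{F}_2$ are independent and uniformly random. For real $x$ and $r\in\mathbb{N}$ write $\binom{x}{r}=\frac{x(x-1)\cdots(x-r+1)}{r!}$.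 **Theorem (Low-degree polynomials extract from sumset sources).** There exists a constant $C>0$ such that for all integers $n\ge k\ge d\ge 2$ and all real $\varepsilon>0$ with $$k\ \ge\ C\,d\,(n/\varepsilon^2)^{1/\lfloor d/2\rfloor},$$ a random degree $d$ polynomial $f:\mathbb{F}_2^n\to\mathbb{F}_2$ is an $\varepsilon$-extractor for $(n,k)$-sumset sources with probability at least $$1-2^{-\varepsilon^2\binom{k/C}{2\lfloor d/2\rfloor}},$$ and also with probability at least $1-2^{-n^2/\varepsilon^2}$. Moreover, whenever $\varepsilon^2\le n$ (in particular, whenever $\varepsilon\le 1$), $$1-2^{-\varepsilon^2\binom{k/C}{2\lfloor d/2\rfloor}}\ \ge\ 1-2^{-n^2/\varepsilon^2}.$$ -/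

import Mathlib

noncomputable section

/-- Statistical distance between two distributions on a finite set:
`Δ(P, Q) = (1/2) * ∑ x, |P x - Q x|`. -/
def statDist {β : Type*} [Fintype β] (P Q : PMF β) : ℝ :=
  (1 / 2) * ∑ x, |(P x).toReal - (Q x).toReal|

/-- Min-entropy `H_∞(X) = min_{x ∈ supp X} log₂ (1 / Pr[X = x])`. On a finite type the support is
finite and nonempty, so the infimum is a minimum. -/
def minEntropy {α : Type*} (X : PMF α) : ℝ :=
  ⨅ x : X.support, Real.logb 2 (1 / (X x).toReal)

/-- The distribution of `A + B` for independent `A` and `B`. -/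
def sumLaw {α : Type*} [Add α] (A B : PMF α) : PMF α :=
  A.bind fun a => B.map fun b => a + b

/-- The family of `(n, k)`-sumset sources: laws of `A + B` over `F_2^n`, with `A` and `B`
independent and of min-entropy at least `k`. -/
def sumsetSources (n k : ℕ) : Set (PMF (Fin n → ZMod 2)) :=
  {X | ∃ A B : PMF (Fin n → ZMod 2),
    (k : ℝ) ≤ minEntropy A ∧ (k : ℝ) ≤ minEntropy B ∧ X = sumLaw A B}

/-- `f` is an `ε`-extractor for the family `𝒳`: for all `X ∈ 𝒳`, the distribution of `f(X)` is at
statistical distance at most `ε` from uniform. -/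
def IsExtractor {α β : Type*} [Fintype β] [Nonempty β]
    (𝒳 : Set (PMF α)) (ε : ℝ) (f : α → β) : Prop :=
  ∀ X ∈ 𝒳, statDist (X.map f) (PMF.uniformOfFintype β) ≤ ε

/-- The function `x ↦ ∑_{S ⊆ [n], |S| ≤ d} α_S ∏_{i ∈ S} x_i` on `F_2^n`. -/
def polyFun {n d : ℕ} (α : {S : Finset (Fin n) // S.card ≤ d} → ZMod 2)
    (x : Fin n → ZMod 2) : ZMod 2 :=
  ∑ S, α S * ∏ i ∈ S.1, x i

/-- A random degree `d` polynomial over `F_2^n`: the coefficients `α_S`, `|S| ≤ d`, are independent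
and uniform, that is, the coefficient vector is uniform. -/
def randomPoly (n d : ℕ) : PMF ((Fin n → ZMod 2) → ZMod 2) :=
  (PMF.uniformOfFintype ({S : Finset (Fin n) // S.card ≤ d} → ZMod 2)).map polyFun

/-- Probability that a random degree `d` polynomial over `F_2^n` is an `ε`-extractor for
`(n, k)`-sumset sources. -/
def extractorProb (n k d : ℕ) (ε : ℝ) : ℝ :=
  ((randomPoly n d).toOuterMeasure {f | IsExtractor (sumsetSources n k) ε f}).toReal

end

/-! Put r = ⌊d/2⌋ and t = C(m, r), with m about k/8. The extraction error on A + B is half the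
absolute correlation E (-1)^f(A+B), so it suffices to bound this correlation for all A, B at once.

Probabilistic half: call a grid a_S + b_T of t² points independent if polynomials of degree at most
d take arbitrary values on it. On such a grid a random f has independent uniform values, so the sign
sum exceeds ηt² with probability at most 2exp(-η²t²/2). There are at most 2^(2nt) grids, and t ≫
n/ε² makes the union bound succeed (`card_exists_biased_le`).

Source of independent grids (`IsFibreTuple.independentGrid`): fix a projection `mask n j`. Let all
a_S lie in one fibre of it and be sent by a linear map to the indicators of the r-subsets of [m];
let the projections of the b_T be sent to these indicators likewise. A degree r monomial in the
projection selects T, and a second one then selects S.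

Deterministic half: 2^(2m) points always map linearly onto F_2^m, so large sets contain such tuples,
and subtracting tuples greedily from the measures reduces the correlation to grids
(`abs_sum_mul_le_of_tuples`). To choose j, let the level of a point be the first j at which its
fibre has mass at least τ. If x has level j and y has level at least j, then x lies in one of few
heavy fibres, while such y put mass at most 2τ on every fibre of `mask n j`. So x supplies fibre
tuples and y section tuples; the remaining pairs are treated with the roles exchanged. -/

/-! ### Polynomial functions of bounded degree. -/

/-- The space of functions on `F_2^n` given by polynomials of degree at most `d`. -/
def polySpace (n d : ℕ) : Submodule (ZMod 2) ((Fin n → ZMod 2) → ZMod 2) :=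
  Submodule.span (ZMod 2) {f | ∃ S : Finset (Fin n), S.card ≤ d ∧ f = fun x => ∏ i ∈ S, x i}

theorem polySpace_mono (n : ℕ) {d e : ℕ} (h : d ≤ e) : polySpace n d ≤ polySpace n e := by
  apply Submodule.span_mono
  rintro f ⟨S, hS, rfl⟩
  exact ⟨S, hS.trans h, rfl⟩

theorem exists_polyFun_eq {n d : ℕ} {f : (Fin n → ZMod 2) → ZMod 2} (hf : f ∈ polySpace n d) :
    ∃ α : {S : Finset (Fin n) // S.card ≤ d} → ZMod 2, polyFun α = f := by
  induction hf using Submodule.span_induction with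
  | mem f hf =>
    obtain ⟨S, hS, rfl⟩ := hf
    refine ⟨Pi.single ⟨S, hS⟩ 1, ?_⟩
    funext x
    rw [polyFun, Finset.sum_eq_single ⟨S, hS⟩]
    · simp
    · intro T _ hT
      simp [Pi.single_eq_of_ne hT]
    · simp
  | zero => exact ⟨0, by funext x; simp [polyFun]⟩
  | add f g _ _ ihf ihg =>
    obtain ⟨α, rfl⟩ := ihf
    obtain ⟨β, rfl⟩ := ihg
    exact ⟨α + β, by funext x; simp [polyFun, add_mul, Finset.sum_add_distrib]⟩
  | smul c f _ ih =>
    obtain ⟨α, rfl⟩ := ih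
    exact ⟨c • α, by funext x; simp [polyFun, mul_assoc, Finset.mul_sum]⟩

theorem ZMod.two_mul_self (a : ZMod 2) : a * a = a := by
  revert a; decide

/-- Repeated variables collapse because every element of F_2 is idempotent. -/
theorem prod_mul_prod_eq_prod_union {n : ℕ} (S T : Finset (Fin n)) (x : Fin n → ZMod 2) :
    (∏ i ∈ S, x i) * ∏ i ∈ T, x i = ∏ i ∈ S ∪ T, x i := by
  rw [← Finset.prod_union_inter, ← Finset.sdiff_union_of_subset
    (Finset.inter_subset_union : S ∩ T ⊆ S ∪ T), Finset.prod_union Finset.sdiff_disjoint,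
    mul_assoc, ZMod.two_mul_self]

theorem mul_mem_polySpace {n d e : ℕ} {f g : (Fin n → ZMod 2) → ZMod 2}
    (hf : f ∈ polySpace n d) (hg : g ∈ polySpace n e) : f * g ∈ polySpace n (d + e) := by
  have h : polySpace n d * polySpace n e ≤ polySpace n (d + e) := by
    rw [polySpace, polySpace, Submodule.span_mul_span]
    apply Submodule.span_mono
    rintro _ ⟨_, ⟨S, hS, rfl⟩, _, ⟨T, hT, rfl⟩, rfl⟩
    refine ⟨S ∪ T, (Finset.card_union_le S T).trans (add_le_add hS hT), ?_⟩
    funext x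
    exact prod_mul_prod_eq_prod_union S T x
  exact h (Submodule.mul_mem_mul hf hg)

theorem const_mem_polySpace (n d : ℕ) (c : ZMod 2) : (fun _ => c) ∈ polySpace n d := by
  have h : (fun _ => (1 : ZMod 2)) ∈ polySpace n d :=
    Submodule.subset_span ⟨∅, by simp, by simp⟩
  simpa [Pi.smul_def] using (polySpace n d).smul_mem c h

theorem affine_mem_polySpace {n : ℕ} (l : (Fin n → ZMod 2) →ₗ[ZMod 2] ZMod 2) (c : ZMod 2) :
    (fun x => l x + c) ∈ polySpace n 1 := by
  refine (polySpace n 1).add_mem ?_ (const_mem_polySpace n 1 c)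
  have h : ⇑l = ∑ i, l (Pi.single i 1) • fun x : Fin n → ZMod 2 => x i := by
    funext x
    rw [LinearMap.pi_apply_eq_sum_univ l x]
    simp only [Finset.sum_apply, Pi.smul_apply, smul_eq_mul]
    refine Finset.sum_congr rfl fun i _ => ?_
    rw [mul_comm]
    congr 2
    funext j
    simp [Pi.single_apply, eq_comm]
  rw [h]
  refine Submodule.sum_mem _ fun i _ => Submodule.smul_mem _ _ (Submodule.subset_span ?_)
  exact ⟨{i}, by simp, by simp⟩

theorem prod_mem_polySpace {n : ℕ} {ι : Type*} (s : Finset ι)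
    (f : ι → (Fin n → ZMod 2) → ZMod 2) (hf : ∀ i ∈ s, f i ∈ polySpace n 1) :
    (fun x => ∏ i ∈ s, f i x) ∈ polySpace n s.card := by
  classical
  induction s using Finset.induction_on with
  | empty => simpa using const_mem_polySpace n 0 1
  | insert a s ha ih =>
    rw [Finset.card_insert_of_notMem ha, add_comm]
    have := mul_mem_polySpace (hf a (Finset.mem_insert_self a s))
      (ih fun i hi => hf i (Finset.mem_insert_of_mem hi))
    simpa [Finset.prod_insert ha, Pi.mul_def] using this

/-! ### Linear maps from large sets onto F_2^m. -/

theorem ZMod.two_ne_zero_iff {a : ZMod 2} : a ≠ 0 ↔ a = 1 := by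
  revert a; decide

/-- Among a finite family of nonzero vectors, some linear functional kills at most half. -/
theorem exists_functional_halving {n : ℕ} {κ : Type*} (E : Finset κ) (v : κ → Fin n → ZMod 2)
    (hv : ∀ e ∈ E, v e ≠ 0) :
    ∃ l : (Fin n → ZMod 2) →ₗ[ZMod 2] ZMod 2, 2 * (E.filter fun e => l (v e) = 0).card ≤ E.card := by
  classical
  let D : (Fin n → ZMod 2) → (Fin n → ZMod 2) →ₗ[ZMod 2] ZMod 2 := fun w =>
    ∑ i, w i • LinearMap.proj i
  have hD : ∀ w x, D w x = ∑ i, w i * x i := fun w x => by simp [D]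
  have hhalf : ∀ e ∈ E, 2 * (Finset.univ.filter fun w => D w (v e) = 0).card =
      Fintype.card (Fin n → ZMod 2) := by
    intro e he
    obtain ⟨i, hi⟩ := Function.ne_iff.1 (hv e he)
    have hi1 : v e i = 1 := ZMod.two_ne_zero_iff.1 hi
    -- Flipping the i-th coefficient, where v e has entry 1, exchanges the functionals that kill v e
    -- with those that do not.
    have hflip : ∀ w, D (w + Pi.single i 1) (v e) = D w (v e) + 1 := by
      intro w
      simp [hD, add_mul, Finset.sum_add_distrib, Pi.single_apply, hi1]
    have hss : ∀ w : Fin n → ZMod 2, w + Pi.single i 1 + Pi.single i 1 = w := by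
      intro w
      funext j
      rw [Pi.add_apply, Pi.add_apply, add_assoc, CharTwo.add_self_eq_zero, add_zero]
    have hcard : (Finset.univ.filter fun w => D w (v e) = 0).card =
        (Finset.univ.filter fun w => ¬ D w (v e) = 0).card := by
      refine Finset.card_bij' (fun w _ => w + Pi.single i 1) (fun w _ => w + Pi.single i 1)
        ?_ ?_ (fun w _ => hss w) (fun w _ => hss w)
      · intro w hw
        simp only [Finset.mem_filter, Finset.mem_univ, true_and] at hw ⊢
        simp [hflip, hw]
      · intro w hw
        simp only [Finset.mem_filter, Finset.mem_univ, true_and] at hw ⊢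
        rw [hflip, ZMod.two_ne_zero_iff.1 hw]
        decide
    have := Finset.card_filter_add_card_filter_not (s := (Finset.univ : Finset (Fin n → ZMod 2)))
      (fun w => D w (v e) = 0)
    rw [← hcard, Finset.card_univ] at this
    omega
  by_contra! hcon
  have h1 : ∑ w : Fin n → ZMod 2, E.card <
      ∑ w : Fin n → ZMod 2, 2 * (E.filter fun e => D w (v e) = 0).card :=
    Finset.sum_lt_sum_of_nonempty Finset.univ_nonempty fun w _ => hcon (D w)
  have h2 : ∑ w : Fin n → ZMod 2, 2 * (E.filter fun e => D w (v e) = 0).card =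
      ∑ e ∈ E, 2 * (Finset.univ.filter fun w => D w (v e) = 0).card := by
    simp only [Finset.card_filter, ← Finset.mul_sum]
    rw [Finset.sum_comm]
  rw [h2, Finset.sum_congr rfl hhalf] at h1
  simp [mul_comm] at h1

/-- Each new coordinate is a functional killing at most half of the differences of the pairs that
still collide. -/
theorem exists_linear_few_collisions {n : ℕ} (P : Finset (Fin n → ZMod 2)) (m : ℕ) :
    ∃ L : (Fin n → ZMod 2) →ₗ[ZMod 2] (Fin m → ZMod 2),
      2 ^ m * (P.offDiag.filter fun p => L p.1 = L p.2).card ≤ P.offDiag.card := by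
  classical
  induction m with
  | zero => exact ⟨0, by simp⟩
  | succ m ih =>
    obtain ⟨L, hL⟩ := ih
    obtain ⟨l, hl⟩ := exists_functional_halving (P.offDiag.filter fun p => L p.1 = L p.2)
      (fun p => p.1 - p.2) fun p hp => by
        rw [Finset.mem_filter, Finset.mem_offDiag] at hp
        exact sub_ne_zero.2 hp.1.2.2
    let L' : (Fin n → ZMod 2) →ₗ[ZMod 2] (Fin (m + 1) → ZMod 2) :=
      LinearMap.pi (Fin.cons l fun i => (LinearMap.proj i).comp L)
    refine ⟨L', ?_⟩
    have hsub : (P.offDiag.filter fun p => L' p.1 = L' p.2) ⊆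
        ((P.offDiag.filter fun p => L p.1 = L p.2).filter fun p => l (p.1 - p.2) = 0) := by
      intro p hp
      rw [Finset.mem_filter] at hp ⊢
      rw [Finset.mem_filter]
      refine ⟨⟨hp.1, ?_⟩, ?_⟩
      · funext i
        simpa [L'] using congrFun hp.2 i.succ
      · simpa [L', sub_eq_zero] using congrFun hp.2 0
    have := Finset.card_le_card hsub
    calc _ ≤ 2 ^ (m + 1) * _ := Nat.mul_le_mul_left _ this
      _ = 2 ^ m * (2 * _) := by rw [pow_succ]; ring
      _ ≤ 2 ^ m * _ := Nat.mul_le_mul_left _ hl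
      _ ≤ _ := hL

/-- A set of at least `2 ^ (2 * m)` points is mapped onto `F_2^m` by some linear map. -/
theorem exists_linear_surjOn {n : ℕ} (P : Finset (Fin n → ZMod 2)) (m : ℕ)
    (hP : 2 ^ (2 * m) ≤ P.card) :
    ∃ L : (Fin n → ZMod 2) →ₗ[ZMod 2] (Fin m → ZMod 2), ∀ y, ∃ p ∈ P, L p = y := by
  classical
  obtain ⟨L, hL⟩ := exists_linear_few_collisions P m
  refine ⟨L, ?_⟩
  by_contra! hcon
  obtain ⟨y, hy⟩ := hcon
  have himg : (P.image L).card + 1 ≤ 2 ^ m := by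
    have : P.image L ⊆ Finset.univ.erase y := by
      intro z hz
      obtain ⟨p, hp, rfl⟩ := Finset.mem_image.1 hz
      exact Finset.mem_erase.2 ⟨hy p hp, Finset.mem_univ _⟩
    have := Finset.card_le_card this
    rw [Finset.card_erase_of_mem (Finset.mem_univ _), Finset.card_univ] at this
    simp at this
    have h2 : 0 < 2 ^ m := by positivity
    omega
  -- Cauchy-Schwarz over the fibres of L: the sum of squared fibre sizes counts the colliding pairs,
  -- diagonal included.
  have hcs : P.card ^ 2 ≤ (P.image L).card *
      (P.card + (P.offDiag.filter fun p => L p.1 = L p.2).card) := by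
    have h1 : P.card = ∑ z ∈ P.image L, (P.filter fun p => L p = z).card :=
      Finset.card_eq_sum_card_image L P
    have h2 : ∑ z ∈ P.image L, (P.filter fun p => L p = z).card ^ 2 =
        ((P ×ˢ P).filter fun p => L p.1 = L p.2).card := by
      rw [Finset.card_eq_sum_card_fiberwise (f := fun p => L p.1) (t := P.image L)]
      · refine Finset.sum_congr rfl fun z _ => ?_
        rw [sq, ← Finset.card_product]
        congr 1
        ext p
        simp only [Finset.mem_filter, Finset.mem_product]
        constructor
        · rintro ⟨⟨h1, h2⟩, h3, h4⟩
          exact ⟨⟨⟨h1, h3⟩, h2.trans h4.symm⟩, h2⟩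
        · rintro ⟨⟨⟨h1, h3⟩, h2⟩, h4⟩
          exact ⟨⟨h1, h4⟩, h3, h2 ▸ h4⟩
      · intro p hp
        simp only [Finset.coe_filter, Set.mem_ofPred_eq, Finset.mem_product] at hp
        exact Finset.mem_coe.2 (Finset.mem_image_of_mem _ hp.1.1)
    have h3 : ((P ×ˢ P).filter fun p => L p.1 = L p.2).card =
        P.card + (P.offDiag.filter fun p => L p.1 = L p.2).card := by
      rw [← Finset.diag_union_offDiag, Finset.filter_union, Finset.card_union_of_disjoint]
      · congr 1
        rw [Finset.filter_true_of_mem, Finset.diag_card]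
        intro p hp
        rw [(Finset.mem_diag.1 hp).2]
      · exact Finset.disjoint_filter_filter (Finset.disjoint_diag_offDiag P)
    rw [← h3, ← h2]
    conv_lhs => rw [h1]
    exact sq_sum_le_card_mul_sum_sq
  rw [Finset.offDiag_card] at hL
  have hN : (1 : ℝ) ≤ 2 ^ m := one_le_pow₀ (by norm_num)
  have hoff : (2 : ℝ) ^ m * ((P.offDiag.filter fun p => L p.1 = L p.2).card : ℝ) ≤
      (P.card : ℝ) * P.card - P.card := by
    rw [← Nat.cast_mul, ← Nat.cast_sub (Nat.le_mul_self _)]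
    exact_mod_cast hL
  have himg' : ((P.image L).card : ℝ) + 1 ≤ 2 ^ m := by exact_mod_cast himg
  have hcs' : (P.card : ℝ) ^ 2 ≤ ((P.image L).card : ℝ) *
      (P.card + (P.offDiag.filter fun p => L p.1 = L p.2).card) := by exact_mod_cast hcs
  have hP' : ((2 : ℝ) ^ m) ^ 2 ≤ P.card := by
    rw [← pow_mul, mul_comm m 2]; exact_mod_cast hP
  have hc : (0 : ℝ) ≤ (P.offDiag.filter fun p => L p.1 = L p.2).card := Nat.cast_nonneg _
  generalize ((P.offDiag.filter fun p => L p.1 = L p.2).card : ℝ) = c at *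
  generalize (2 : ℝ) ^ m = N at *
  generalize ((P.image L).card : ℝ) = i at *
  generalize hp : (P.card : ℝ) = p at *
  have hpp : 0 < p := by nlinarith
  have h1 : p ^ 2 ≤ (N - 1) * (p + c) := hcs'.trans (by gcongr; linarith)
  have h2 : N * p ^ 2 ≤ (N - 1) * (N * p + (p * p - p)) := by
    calc N * p ^ 2 ≤ N * ((N - 1) * (p + c)) := by gcongr
      _ = (N - 1) * (N * p + N * c) := by ring
      _ ≤ _ := by gcongr
  -- Divided by p, `h2` says p ≤ (N - 1)², against N² ≤ p.
  nlinarith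

/-! ### Fibre tuples, section tuples and independent grids. -/

/-- The linear projection of `F_2^n` keeping the coordinates of index at least `j`. -/
def mask (n j : ℕ) : (Fin n → ZMod 2) →ₗ[ZMod 2] (Fin n → ZMod 2) :=
  LinearMap.pi fun i => if j ≤ i.val then LinearMap.proj i else 0

theorem mask_apply {n j : ℕ} (x : Fin n → ZMod 2) (i : Fin n) :
    mask n j x i = if j ≤ i.val then x i else 0 := by
  rw [mask, LinearMap.pi_apply]
  split_ifs <;> rfl

theorem mask_mask {n j : ℕ} (x : Fin n → ZMod 2) : mask n j (mask n j x) = mask n j x := by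
  funext i
  simp only [mask_apply]
  split_ifs <;> rfl

theorem mask_eq_iff {n j : ℕ} {x y : Fin n → ZMod 2} :
    mask n j x = mask n j y ↔ ∀ i : Fin n, j ≤ i.val → x i = y i := by
  simp only [funext_iff, mask_apply]
  refine forall_congr' fun i => ?_
  split_ifs with h <;> simp [h]

/-- The points of the grid `a i + b l` have a dual system of polynomials of degree at most `d`. -/
def IndependentGrid {n : ℕ} {ι κ : Type*} (d : ℕ) (a : ι → Fin n → ZMod 2)
    (b : κ → Fin n → ZMod 2) : Prop :=
  ∀ i l, ∃ f ∈ polySpace n d, f (a i + b l) = 1 ∧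
    ∀ i₁ l₁, (i₁, l₁) ≠ (i, l) → f (a i₁ + b l₁) = 0

/-- Index set of subsets of size `r` of `Fin m`. -/
abbrev SizedSubset (m r : ℕ) : Type := {S : Finset (Fin m) // S.card = r}

theorem card_sizedSubset (m r : ℕ) : Fintype.card (SizedSubset m r) = m.choose r := by
  rw [Fintype.card_finset_len, Fintype.card_fin]

/-- The indicator vector of a set of coordinates. -/
def indicatorVec {m r : ℕ} (S : SizedSubset m r) : Fin m → ZMod 2 := fun i => if i ∈ S.1 then 1 else 0

theorem indicatorVec_injective {m r : ℕ} :
    Function.Injective (indicatorVec : SizedSubset m r → Fin m → ZMod 2) := by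
  intro S T h
  apply Subtype.ext
  ext i
  have := congrFun h i
  simp only [indicatorVec] at this
  by_cases h1 : i ∈ S.1 <;> by_cases h2 : i ∈ T.1 <;> simp_all

/-- Among sets of equal size, inclusion is equality; hence degree r monomials are dual to the
indicator vectors. -/
theorem prod_indicatorVec {m r : ℕ} (S T : SizedSubset m r) :
    ∏ i ∈ S.1, indicatorVec T i = if T = S then 1 else 0 := by
  split_ifs with h
  · subst h
    exact Finset.prod_eq_one fun i hi => by simp [indicatorVec, hi]
  · have : ¬ S.1 ⊆ T.1 := fun hsub => h <| Subtype.ext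
      (Finset.eq_of_subset_of_card_le hsub (by rw [S.2, T.2])).symm
    obtain ⟨i, hi, hiT⟩ := Finset.not_subset.1 this
    exact Finset.prod_eq_zero hi (by simp [indicatorVec, hiT])

/-- Tuples in one fibre of `mask n j` that a linear map sends to the indicator vectors. -/
def IsFibreTuple {n m r : ℕ} (j : ℕ) (a : SizedSubset m r → Fin n → ZMod 2) : Prop :=
  (∃ v, ∀ S, mask n j (a S) = v) ∧
    ∃ L : (Fin n → ZMod 2) →ₗ[ZMod 2] (Fin m → ZMod 2), ∀ S, L (a S) = indicatorVec S

/-- Tuples whose projections by `mask n j` are sent by a linear map to the indicator vectors. -/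
def IsSectionTuple {n m r : ℕ} (j : ℕ) (b : SizedSubset m r → Fin n → ZMod 2) : Prop :=
  ∃ L : (Fin n → ZMod 2) →ₗ[ZMod 2] (Fin m → ZMod 2), ∀ S, L (mask n j (b S)) = indicatorVec S

theorem IsFibreTuple.injective {n m r j : ℕ} {a : SizedSubset m r → Fin n → ZMod 2}
    (h : IsFibreTuple j a) : Function.Injective a := by
  obtain ⟨_, L, hL⟩ := h
  intro S T hST
  apply indicatorVec_injective
  rw [← hL, ← hL, hST]

theorem IsSectionTuple.injective {n m r j : ℕ} {b : SizedSubset m r → Fin n → ZMod 2}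
    (h : IsSectionTuple j b) : Function.Injective b := by
  obtain ⟨L, hL⟩ := h
  intro S T hST
  apply indicatorVec_injective
  rw [← hL, ← hL, hST]

theorem prod_affine_mem_polySpace {n m r : ℕ} (S : SizedSubset m r)
    (L : (Fin n → ZMod 2) →ₗ[ZMod 2] (Fin m → ZMod 2)) (v : Fin n → ZMod 2) :
    (fun x => ∏ i ∈ S.1, L (x - v) i) ∈ polySpace n r := by
  have := prod_mem_polySpace S.1 (fun i x => L (x - v) i) fun i _ => by
    have := affine_mem_polySpace ((LinearMap.proj i).comp L) (-(L v i))
    simpa [sub_eq_add_neg] using this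
  rwa [S.2] at this

theorem IsFibreTuple.independentGrid {n m r j d : ℕ} (hd : 2 * r ≤ d)
    {a b : SizedSubset m r → Fin n → ZMod 2} (ha : IsFibreTuple j a) (hb : IsSectionTuple j b) :
    IndependentGrid d a b := by
  obtain ⟨⟨v, hv⟩, L, hL⟩ := ha
  obtain ⟨M, hM⟩ := hb
  intro S T
  -- All a S' have the same projection v, so the first factor at a S' + b T' depends only on T' and
  -- vanishes unless T' = T. In that case subtracting b T leaves a S', and the second factor tests
  -- S' = S.
  have hmem : (fun x => (∏ i ∈ T.1, (M.comp (mask n j)) (x - v) i) * ∏ i ∈ S.1, L (x - b T) i) ∈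
      polySpace n d :=
    polySpace_mono n (by omega) (mul_mem_polySpace
      (prod_affine_mem_polySpace T (M.comp (mask n j)) v) (prod_affine_mem_polySpace S L (b T)))
  have hval : ∀ S' T', (∏ i ∈ T.1, (M.comp (mask n j)) (a S' + b T' - v) i) =
      if T' = T then 1 else 0 := by
    intro S' T'
    rw [← prod_indicatorVec]
    refine Finset.prod_congr rfl fun i _ => ?_
    rw [LinearMap.comp_apply, map_sub, map_add, hv, ← hv S', mask_mask, add_sub_cancel_left, hM]
  refine ⟨_, hmem, ?_, ?_⟩
  · simp only [hval, add_sub_cancel_right, hL, prod_indicatorVec]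
    simp
  · intro S' T' hne
    simp only [hval]
    by_cases hT : T' = T
    · subst hT
      have hS : S' ≠ S := fun h => hne (by rw [h])
      simp only [add_sub_cancel_right, hL, prod_indicatorVec]
      simp [hS]
    · simp [hT]

theorem exists_isFibreTuple {n : ℕ} (m r j : ℕ) (P : Finset (Fin n → ZMod 2)) (v : Fin n → ZMod 2)
    (hv : ∀ x ∈ P, mask n j x = v) (hP : 2 ^ (2 * m) ≤ P.card) :
    ∃ a : SizedSubset m r → Fin n → ZMod 2, IsFibreTuple j a ∧ ∀ S, a S ∈ P := by
  obtain ⟨L, hL⟩ := exists_linear_surjOn P m hP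
  choose p hp hLp using hL
  exact ⟨fun S => p (indicatorVec S), ⟨⟨v, fun S => hv _ (hp _)⟩, L, fun S => hLp _⟩, fun S => hp _⟩

theorem exists_isSectionTuple {n : ℕ} (m r j : ℕ) (P : Finset (Fin n → ZMod 2))
    (hP : 2 ^ (2 * m) ≤ (P.image (mask n j)).card) :
    ∃ b : SizedSubset m r → Fin n → ZMod 2, IsSectionTuple j b ∧ ∀ S, b S ∈ P := by
  obtain ⟨L, hL⟩ := exists_linear_surjOn _ m hP
  choose p hp hLp using hL
  choose q hq hqp using fun y => Finset.mem_image.1 (hp y)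
  exact ⟨fun S => q (indicatorVec S), ⟨L, fun S => by rw [hqp, hLp]⟩, fun S => hq _⟩

/-! ### Concentration of a random polynomial on an independent grid. -/

/-- The sign `(-1) ^ z`. -/
def sgn (z : ZMod 2) : ℝ := if z = 0 then 1 else -1

theorem abs_sgn (z : ZMod 2) : |sgn z| = 1 := by
  unfold sgn; split_ifs <;> simp

theorem sgn_zero : sgn 0 = 1 := if_pos rfl

theorem sgn_one : sgn 1 = -1 := if_neg one_ne_zero

theorem ZMod.sum_univ_two (F : ZMod 2 → ℝ) : ∑ z, F z = F 0 + F 1 := Fin.sum_univ_two F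

/-- Moment generating function of a sum of independent uniform signs. -/
theorem sum_exp_sum_sgn_le {κ : Type*} [Fintype κ] [DecidableEq κ] (s : ℝ) :
    ∑ g : κ → ZMod 2, Real.exp (s * ∑ i, sgn (g i)) ≤
      Fintype.card (κ → ZMod 2) * Real.exp (Fintype.card κ * (s ^ 2 / 2)) := by
  have h1 : ∀ g : κ → ZMod 2, Real.exp (s * ∑ i, sgn (g i)) = ∏ i, Real.exp (s * sgn (g i)) := by
    intro g
    rw [Finset.mul_sum, Real.exp_sum]
  simp only [h1]
  rw [← Fintype.prod_sum (fun (_ : κ) (z : ZMod 2) => Real.exp (s * sgn z))]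
  have h2 : ∑ z : ZMod 2, Real.exp (s * sgn z) = 2 * Real.cosh s := by
    rw [Real.cosh_eq]
    rw [ZMod.sum_univ_two, sgn_zero, sgn_one, mul_one, mul_neg_one]
    ring
  rw [h2, Finset.prod_const, Finset.card_univ, mul_pow, Fintype.card_fun, ZMod.card, Real.exp_nat_mul]
  push_cast
  gcongr
  exact Real.cosh_le_exp_half_sq s

/-- A surjective homomorphism of finite groups pushes sums forward uniformly. -/
theorem sum_comp_eq_of_surjective {G H : Type*} [AddCommGroup G] [Fintype G] [AddCommGroup H]
    [Fintype H] (φ : G →+ H) (hφ : Function.Surjective φ) (F : H → ℝ) :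
    (Fintype.card H : ℝ) * ∑ g, F (φ g) = Fintype.card G * ∑ h, F h := by
  classical
  have hfib : ∀ h : H, (Finset.univ.filter fun g => φ g = h).card =
      (Finset.univ.filter fun g => φ g = 0).card := by
    intro h
    obtain ⟨g₀, rfl⟩ := hφ h
    refine Finset.card_bij' (fun g _ => g - g₀) (fun g _ => g + g₀) ?_ ?_ ?_ ?_ <;>
      simp +contextual
  have h1 : ∀ F : H → ℝ, ∑ g, F (φ g) =
      (Finset.univ.filter fun g => φ g = 0).card * ∑ h, F h := by
    intro F
    rw [← Finset.sum_fiberwise Finset.univ φ, Finset.mul_sum]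
    refine Finset.sum_congr rfl fun h _ => ?_
    rw [Finset.sum_congr rfl (g := fun _ => F h), Finset.sum_const, hfib, nsmul_eq_mul]
    intro g hg
    rw [(Finset.mem_filter.1 hg).2]
  have h2 := h1 fun _ => 1
  simp only [Finset.sum_const, Finset.card_univ, nsmul_eq_mul, mul_one] at h2
  rw [h1 F, h2]
  ring

/-- Coefficient vectors of polynomials of degree at most `d`. -/
abbrev Coeffs (n d : ℕ) : Type := {S : Finset (Fin n) // S.card ≤ d} → ZMod 2

theorem polyFun_add {n d : ℕ} (α β : Coeffs n d) (x : Fin n → ZMod 2) :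
    polyFun (α + β) x = polyFun α x + polyFun β x := by
  simp [polyFun, add_mul, Finset.sum_add_distrib]

/-- Evaluation of polynomials at a finite family of points. -/
def evalHom {n : ℕ} (d : ℕ) {κ : Type*} (p : κ → Fin n → ZMod 2) : Coeffs n d →+ (κ → ZMod 2) where
  toFun α i := polyFun α (p i)
  map_zero' := by funext i; simp [polyFun]
  map_add' α β := by funext i; exact polyFun_add α β (p i)

/-- Interpolation by the dual polynomials. A surjective homomorphism sends uniform to uniform, so
the values of a random polynomial on the grid are independent uniform bits. -/
theorem IndependentGrid.evalHom_surjective {n d : ℕ} {ι κ : Type*} [Fintype ι] [Fintype κ]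
    {a : ι → Fin n → ZMod 2} {b : κ → Fin n → ZMod 2} (h : IndependentGrid d a b) :
    Function.Surjective (evalHom d fun q : ι × κ => a q.1 + b q.2) := by
  classical
  have hs : ∀ q : ι × κ, ∃ α : Coeffs n d,
      evalHom d (fun q : ι × κ => a q.1 + b q.2) α = Pi.single q 1 := by
    intro q
    obtain ⟨f, hf, h1, h0⟩ := h q.1 q.2
    obtain ⟨α, rfl⟩ := exists_polyFun_eq hf
    refine ⟨α, ?_⟩
    funext q'
    by_cases hq : q' = q
    · subst hq; simpa [evalHom] using h1
    · rw [Pi.single_eq_of_ne hq]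
      exact h0 q'.1 q'.2 hq
  choose A hA using hs
  intro g
  -- `evalHom` is only additive, so the coefficients in F_2 enter as natural number multiples.
  refine ⟨∑ q, (g q).val • A q, ?_⟩
  rw [map_sum]
  simp only [map_nsmul, hA]
  funext q
  rw [Finset.sum_apply, Finset.sum_eq_single q]
  · simp
  · intro q' _ hq'
    simp [Pi.single_eq_of_ne hq'.symm]
  · simp

/-- Chernoff bound for the values of a random polynomial on an independent grid. -/
theorem card_biased_le {n d : ℕ} {ι κ : Type*} [Fintype ι] [Fintype κ]
    {a : ι → Fin n → ZMod 2} {b : κ → Fin n → ZMod 2} (h : IndependentGrid d a b) {η : ℝ}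
    (hη : 0 ≤ η) :
    ((Finset.univ.filter fun α : Coeffs n d =>
      η * (Fintype.card ι * Fintype.card κ) < |∑ i, ∑ l, sgn (polyFun α (a i + b l))|).card : ℝ) ≤
      Fintype.card (Coeffs n d) *
        (2 * Real.exp (-(η ^ 2 * (Fintype.card ι * Fintype.card κ) / 2))) := by
  classical
  set N : ℝ := Fintype.card ι * Fintype.card κ with hN
  have hNκ : (Fintype.card (ι × κ) : ℝ) = N := by rw [Fintype.card_prod]; push_cast; rfl
  let X : Coeffs n d → ℝ := fun α => ∑ i, ∑ l, sgn (polyFun α (a i + b l))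
  have hmgf : ∀ s : ℝ, ∑ α, Real.exp (s * X α) ≤
      Fintype.card (Coeffs n d) * Real.exp (N * (s ^ 2 / 2)) := by
    intro s
    have h1 := sum_comp_eq_of_surjective _ h.evalHom_surjective
      (fun g => Real.exp (s * ∑ q, sgn (g q)))
    have h2 := sum_exp_sum_sgn_le (κ := ι × κ) s
    rw [hNκ] at h2
    have hpos : (0 : ℝ) < Fintype.card (ι × κ → ZMod 2) := by exact_mod_cast Fintype.card_pos
    have h3 : ∀ α, ∑ q, sgn (evalHom d (fun q : ι × κ => a q.1 + b q.2) α q) = X α := by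
      intro α
      rw [Fintype.sum_prod_type]
      rfl
    simp only [h3] at h1
    refine le_of_mul_le_mul_left ?_ hpos
    rw [h1]
    exact (mul_le_mul_of_nonneg_left h2 (Nat.cast_nonneg _)).trans_eq (by ring)
  have hone : ∀ s : ℝ, (s = η ∨ s = -η) →
      ((Finset.univ.filter fun α => η ^ 2 * N < s * X α).card : ℝ) ≤
        Fintype.card (Coeffs n d) * Real.exp (-(η ^ 2 * N / 2)) := by
    intro s hs
    have hs2 : s ^ 2 = η ^ 2 := by rcases hs with rfl | rfl <;> ring
    have h1 : ((Finset.univ.filter fun α => η ^ 2 * N < s * X α).card : ℝ) * Real.exp (η ^ 2 * N) ≤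
        ∑ α, Real.exp (s * X α) := by
      rw [← nsmul_eq_mul, ← Finset.sum_const]
      refine (Finset.sum_le_sum fun α hα => ?_).trans (Finset.sum_le_sum_of_subset_of_nonneg
        (Finset.filter_subset _ _) fun _ _ _ => (Real.exp_pos _).le)
      exact Real.exp_le_exp.2 (Finset.mem_filter.1 hα).2.le
    have h2 := h1.trans (hmgf s)
    rw [hs2] at h2
    rw [← le_div_iff₀ (Real.exp_pos _), mul_div_assoc, ← Real.exp_sub] at h2
    have he : N * (η ^ 2 / 2) - η ^ 2 * N = -(η ^ 2 * N / 2) := by ring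
    rwa [he] at h2
  rcases hη.eq_or_lt with rfl | hη
  -- For η = 0 the claimed bound is twice the total count; the main case multiplies by η and needs
  -- it positive.
  · have := Finset.card_filter_le (Finset.univ : Finset (Coeffs n d)) (fun α => 0 * N < |X α|)
    rw [Finset.card_univ] at this
    have h' : ((Finset.univ.filter fun α => 0 * N < |X α|).card : ℝ) ≤ Fintype.card (Coeffs n d) := by
      exact_mod_cast this
    refine h'.trans ?_
    simp
  · have hsub : (Finset.univ.filter fun α => η * N < |X α|) ⊆
        (Finset.univ.filter fun α => η ^ 2 * N < η * X α) ∪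
          (Finset.univ.filter fun α => η ^ 2 * N < -η * X α) := by
      intro α hα
      simp only [Finset.mem_union, Finset.mem_filter, Finset.mem_univ, true_and] at hα ⊢
      rcases lt_abs.1 hα with h | h
      · left; nlinarith
      · right; nlinarith
    have h1 := (Finset.card_le_card hsub).trans (Finset.card_union_le _ _)
    have h2 : ((Finset.univ.filter fun α => η * N < |X α|).card : ℝ) ≤
        (Finset.univ.filter fun α => η ^ 2 * N < η * X α).card +
          (Finset.univ.filter fun α => η ^ 2 * N < -η * X α).card := by exact_mod_cast h1
    have h3 := hone η (Or.inl rfl)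
    have h4 := hone (-η) (Or.inr rfl)
    change ((Finset.univ.filter fun α => η * N < |X α|).card : ℝ) ≤ _
    linarith

/-! ### Greedy removal of tuples from a measure. -/

/-- If every set of large mass contains a tuple on which `φ` has small average, then `φ` has small
integral: remove such tuples greedily from the measure. -/
theorem abs_sum_mul_le_of_tuples {V ι : Type*} [Fintype V] [Fintype ι] [Nonempty ι]
    {good : (ι → V) → Prop} (hinj : ∀ a, good a → Function.Injective a) {φ : V → ℝ} {c M lam : ℝ}
    (hc : 0 ≤ c) (hM : 0 ≤ M)
    (hφ : ∀ a, good a → |∑ i, φ (a i)| ≤ c * Fintype.card ι) (hφM : ∀ x, |φ x| ≤ M) (ν : V → ℝ)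
    (hν : ∀ x, 0 ≤ ν x)
    (hW : ∀ W : Finset V, lam ≤ ∑ x ∈ W, ν x → ∃ a, good a ∧ ∀ i, a i ∈ W) :
    |∑ x, ν x * φ x| ≤ c * ∑ x, ν x + lam * M := by
  classical
  induction hs : (Finset.univ.filter fun x => ν x ≠ 0).card using Nat.strong_induction_on
    generalizing ν with
  | _ N ih =>
  have hν0 : 0 ≤ ∑ x, ν x := Finset.sum_nonneg fun x _ => hν x
  rcases lt_or_ge (∑ x, ν x) lam with hlt | hge
  · calc |∑ x, ν x * φ x| ≤ ∑ x, |ν x * φ x| := Finset.abs_sum_le_sum_abs _ _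
      _ ≤ ∑ x, ν x * M := by
        refine Finset.sum_le_sum fun x _ => ?_
        rw [abs_mul, abs_of_nonneg (hν x)]
        exact mul_le_mul_of_nonneg_left (hφM x) (hν x)
      _ = (∑ x, ν x) * M := by rw [Finset.sum_mul]
      _ ≤ lam * M := by gcongr
      _ ≤ _ := by nlinarith
  · obtain ⟨a, ha, haW⟩ := hW (Finset.univ.filter fun x => ν x ≠ 0)
      (by rwa [Finset.sum_filter_ne_zero])
    obtain ⟨i₀, -, hi₀⟩ := Finset.exists_min_image Finset.univ (fun i => ν (a i))
      Finset.univ_nonempty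
    -- Subtracting the least weight along the tuple keeps the measure nonnegative and removes a
    -- point from its support, on whose size the induction runs.
    set w := ν (a i₀) with hw
    have hwpos : 0 < w := lt_of_le_of_ne (hν _) (Ne.symm (Finset.mem_filter.1 (haW i₀)).2)
    let ν' : V → ℝ := fun x => ν x - ∑ i, if a i = x then w else 0
    have hsum1 : ∀ i, (∑ i', if a i' = a i then w else 0) = w := by
      intro i
      rw [Finset.sum_eq_single i]
      · simp
      · intro i' _ hi'
        rw [if_neg fun h => hi' (hinj a ha h)]
      · simp
    have hν'le : ∀ x, ν' x ≤ ν x := fun x => sub_le_self _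
      (Finset.sum_nonneg fun i _ => by split_ifs <;> linarith)
    have hν'a : ∀ i, ν' (a i) = ν (a i) - w := fun i => by simp only [ν', hsum1]
    have hν'n : ∀ x, (∀ i, a i ≠ x) → ν' x = ν x := by
      intro x hx
      simp only [ν']
      rw [Finset.sum_eq_zero fun i _ => if_neg (hx i), sub_zero]
    have hν' : ∀ x, 0 ≤ ν' x := by
      intro x
      by_cases hx : ∃ i, a i = x
      · obtain ⟨i, rfl⟩ := hx
        rw [hν'a]
        linarith [hi₀ i (Finset.mem_univ i)]
      · push Not at hx
        rw [hν'n x hx]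
        exact hν x
    have hsumφ : ∀ ψ : V → ℝ, ∑ x, ν' x * ψ x = ∑ x, ν x * ψ x - w * ∑ i, ψ (a i) := by
      intro ψ
      simp only [ν', sub_mul, Finset.sum_sub_distrib, Finset.sum_mul, ite_mul, zero_mul]
      rw [Finset.sum_comm]
      simp [Finset.mul_sum]
    have hcard : (Finset.univ.filter fun x => ν' x ≠ 0).card < N := by
      rw [← hs]
      refine Finset.card_lt_card ((Finset.ssubset_iff_of_subset ?_).2 ⟨a i₀, haW i₀, ?_⟩)
      · intro x hx
        rw [Finset.mem_filter] at hx ⊢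
        refine ⟨hx.1, fun h => hx.2 (le_antisymm (h ▸ hν'le x) (hν' x))⟩
      · simp [hν'a, hw]
    have hrec := ih _ hcard ν' hν'
      (fun W h => hW W (h.trans (Finset.sum_le_sum fun x _ => hν'le x))) rfl
    have hmass := hsumφ fun _ => 1
    simp only [mul_one, Finset.sum_const, Finset.card_univ, nsmul_eq_mul] at hmass
    rw [hmass, hsumφ φ] at hrec
    have h1 := abs_sub_abs_le_abs_sub (∑ x, ν x * φ x) (w * ∑ i, φ (a i))
    rw [abs_mul, abs_of_pos hwpos] at h1
    have h2 := mul_le_mul_of_nonneg_left (hφ a ha) hwpos.le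
    -- The removed part contributes at most w * c * |ι|, which is c times the mass it takes away.
    nlinarith

/-! ### Levels of points and the mass of fibres. -/

/-- Mass of the fibre of `mask n j` through `v`. -/
noncomputable def fibreMass {n : ℕ} (μ : (Fin n → ZMod 2) → ℝ) (j : ℕ) (v : Fin n → ZMod 2) : ℝ :=
  ∑ x with mask n j x = mask n j v, μ x

/-- The least `j` for which the fibre of `mask n j` through `v` has mass at least `τ`. -/
noncomputable def level {n : ℕ} (μ : (Fin n → ZMod 2) → ℝ) (τ : ℝ) (v : Fin n → ZMod 2) : ℕ :=
  sInf {j | τ ≤ fibreMass μ j v}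

theorem fibreMass_top {n : ℕ} {μ : (Fin n → ZMod 2) → ℝ} (v : Fin n → ZMod 2) :
    fibreMass μ n v = ∑ x, μ x := by
  rw [fibreMass, Finset.filter_true_of_mem]
  intro x _
  exact mask_eq_iff.2 fun i hi => absurd i.2 (not_lt.2 hi)

theorem level_le {n : ℕ} {μ : (Fin n → ZMod 2) → ℝ} {τ : ℝ} (h1 : ∑ x, μ x = 1) (hτ : τ ≤ 1)
    (v : Fin n → ZMod 2) : level μ τ v ≤ n :=
  Nat.sInf_le (by rw [Set.mem_ofPred_eq, fibreMass_top, h1]; exact hτ)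

/-- At j = n the fibre is the whole space, of mass 1 ≥ τ, so the infimum is over a nonempty set and
is attained. -/
theorem le_fibreMass_level {n : ℕ} {μ : (Fin n → ZMod 2) → ℝ} {τ : ℝ} (h1 : ∑ x, μ x = 1)
    (hτ : τ ≤ 1) (v : Fin n → ZMod 2) : τ ≤ fibreMass μ (level μ τ v) v :=
  Nat.sInf_mem (s := {j | τ ≤ fibreMass μ j v})
    ⟨n, by rw [Set.mem_ofPred_eq, fibreMass_top, h1]; exact hτ⟩

theorem fibreMass_lt_of_lt_level {n : ℕ} {μ : (Fin n → ZMod 2) → ℝ} {τ : ℝ} {v : Fin n → ZMod 2}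
    {j : ℕ} (h : j < level μ τ v) : fibreMass μ j v < τ :=
  not_le.1 (Nat.notMem_of_lt_sInf h)

/-- A fibre of `mask n (j + 1)` is the union of two fibres of `mask n j`, and one that contains a
point of level above j has mass below τ. For j = 0 fibres are single points. -/
theorem sum_fibre_above_level_le {n : ℕ} {μ : (Fin n → ZMod 2) → ℝ} {τ : ℝ} (h0 : ∀ x, 0 ≤ μ x)
    (h1 : ∑ x, μ x = 1) (hτ : τ ≤ 1) (hμτ : ∀ x, μ x ≤ τ) (j : ℕ) (z : Fin n → ZMod 2) :
    ∑ y with mask n j y = z ∧ j ≤ level μ τ y, μ y ≤ 2 * τ := by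
  have hτ0 : 0 ≤ τ := (h0 0).trans (hμτ 0)
  rcases j with _ | j
  · have : (Finset.univ.filter fun y => mask n 0 y = z ∧ 0 ≤ level μ τ y) ⊆ {z} := by
      intro y hy
      rw [Finset.mem_filter] at hy
      rw [Finset.mem_singleton, ← hy.2.1]
      funext i
      simp [mask_apply]
    calc _ ≤ ∑ y ∈ {z}, μ y := Finset.sum_le_sum_of_subset_of_nonneg this fun _ _ _ => h0 _
      _ ≤ 2 * τ := by rw [Finset.sum_singleton]; linarith [hμτ z]
  · by_cases hj : j < n
    · have key : ∀ c : ZMod 2,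
          ∑ y with (mask n (j + 1) y = z ∧ j + 1 ≤ level μ τ y) ∧ y ⟨j, hj⟩ = c, μ y ≤ τ := by
        intro c
        by_cases hne : ∃ y₀, (mask n (j + 1) y₀ = z ∧ j + 1 ≤ level μ τ y₀) ∧ y₀ ⟨j, hj⟩ = c
        · obtain ⟨y₀, ⟨hz, hl⟩, hc⟩ := hne
          refine le_trans ?_ (fibreMass_lt_of_lt_level (Nat.lt_of_succ_le hl)).le
          refine Finset.sum_le_sum_of_subset_of_nonneg ?_ fun _ _ _ => h0 _
          intro y hy
          rw [Finset.mem_filter] at hy ⊢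
          refine ⟨Finset.mem_univ _, mask_eq_iff.2 fun i hi => ?_⟩
          rcases hi.eq_or_lt with h | h
          · have hi' : i = ⟨j, hj⟩ := Fin.ext h.symm
            rw [hi', hc, hy.2.2]
          · exact mask_eq_iff.1 (hy.2.1.1.trans hz.symm) i h
        · rw [Finset.filter_false_of_mem fun y _ h => hne ⟨y, h⟩, Finset.sum_empty]
          exact hτ0
      rw [← Finset.sum_fiberwise _ fun y => y ⟨j, hj⟩, ZMod.sum_univ_two, Finset.filter_filter,
        Finset.filter_filter]
      linarith [key 0, key 1]
    · rw [Finset.filter_false_of_mem, Finset.sum_empty]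
      · linarith
      · intro y _ h
        have := level_le h1 hτ y
        omega

/-- Each cell names a fibre of mass at least τ, and for each of the n + 1 values of j the fibres
have total mass 1. -/
theorem card_levelCells_mul_le {n : ℕ} {μ : (Fin n → ZMod 2) → ℝ} {τ : ℝ} (h0 : ∀ x, 0 ≤ μ x)
    (h1 : ∑ x, μ x = 1) (hτ : τ ≤ 1) :
    ((Finset.univ.image fun x => (level μ τ x, mask n (level μ τ x) x)).card : ℝ) * τ ≤ n + 1 := by
  classical
  rw [← nsmul_eq_mul, ← Finset.sum_const]
  calc ∑ q ∈ Finset.univ.image fun x => (level μ τ x, mask n (level μ τ x) x), τ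
      ≤ ∑ q ∈ Finset.univ.image fun x => (level μ τ x, mask n (level μ τ x) x),
          ∑ x with mask n q.1 x = q.2, μ x := by
        refine Finset.sum_le_sum fun q hq => ?_
        obtain ⟨x, -, rfl⟩ := Finset.mem_image.1 hq
        exact le_fibreMass_level h1 hτ x
    _ ≤ ∑ q ∈ Finset.range (n + 1) ×ˢ (Finset.univ : Finset (Fin n → ZMod 2)),
          ∑ x with mask n q.1 x = q.2, μ x := by
        refine Finset.sum_le_sum_of_subset_of_nonneg ?_ fun _ _ _ => Finset.sum_nonneg fun _ _ => h0 _
        intro q hq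
        obtain ⟨x, -, rfl⟩ := Finset.mem_image.1 hq
        simpa [Nat.lt_succ_iff] using level_le h1 hτ x
    _ = n + 1 := by
        rw [Finset.sum_product]
        simp only [Finset.sum_fiberwise, h1]
        simp

/-! ### From grids to the correlation of two measures. -/

/-- The part of the correlation sum coming from one fibre of `mask n j`. -/
theorem abs_sum_cell_le {n m r j : ℕ} (hr : r ≤ m) {χ : (Fin n → ZMod 2) → ℝ} {η δ lam τ K : ℝ}
    (hχ : ∀ x, |χ x| ≤ 1) (hη : 0 ≤ η) (hδ : 0 ≤ δ) (hτ0 : 0 < τ) (hK : 0 < K)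
    (hgrid : ∀ a b : SizedSubset m r → Fin n → ZMod 2, IsFibreTuple j a → IsSectionTuple j b →
      |∑ S, ∑ T, χ (a S + b T)| ≤ η * (m.choose r * m.choose r))
    {μ ν : (Fin n → ZMod 2) → ℝ} (hμ0 : ∀ x, 0 ≤ μ x) (hν0 : ∀ x, 0 ≤ ν x)
    (hμK : ∀ x, μ x ≤ K) (z : Fin n → ZMod 2) (hμz : ∀ x, μ x ≠ 0 → mask n j x = z)
    (hν1 : ∑ y, ν y ≤ 1) (hντ : ∀ z, ∑ y with mask n j y = z, ν y ≤ 2 * τ)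
    (hδτ : 2 ^ (2 * m) * (2 * τ) ≤ δ) (hlamK : 2 ^ (2 * m) * K ≤ lam) :
    |∑ x, μ x * ∑ y, ν y * χ (x + y)| ≤ (η + δ) * ∑ x, μ x + lam := by
  classical
  have hcard : (Fintype.card (SizedSubset m r) : ℝ) = m.choose r := by rw [card_sizedSubset]
  have hcpos : 0 < m.choose r := Nat.choose_pos hr
  have : Nonempty (SizedSubset m r) := Fintype.card_pos_iff.1 (by rwa [card_sizedSubset])
  have hcpos' : (0 : ℝ) < m.choose r := by exact_mod_cast hcpos
  have hsec : ∀ W : Finset (Fin n → ZMod 2), δ ≤ ∑ x ∈ W, ν x →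
      ∃ b : SizedSubset m r → Fin n → ZMod 2, IsSectionTuple j b ∧ ∀ i, b i ∈ W := by
    intro W hW
    apply exists_isSectionTuple
    -- Each fibre carries mass at most 2τ, so mass δ must meet at least 2^(2m) fibres.
    have : ∑ x ∈ W, ν x ≤ (W.image (mask n j)).card * (2 * τ) := by
      rw [← Finset.sum_fiberwise_of_maps_to (fun x hx => Finset.mem_image_of_mem (mask n j) hx) ν,
        ← nsmul_eq_mul]
      refine Finset.sum_le_card_nsmul _ _ _ fun z _ => le_trans ?_ (hντ z)
      exact Finset.sum_le_sum_of_subset_of_nonneg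
        (Finset.filter_subset_filter _ (Finset.subset_univ W)) fun _ _ _ => hν0 _
    have h2 := le_of_mul_le_mul_right ((hδτ.trans hW).trans this) (by linarith)
    exact_mod_cast h2
  have hfib : ∀ W : Finset (Fin n → ZMod 2), lam ≤ ∑ x ∈ W, μ x →
      ∃ a : SizedSubset m r → Fin n → ZMod 2, IsFibreTuple j a ∧ ∀ i, a i ∈ W := by
    intro W hW
    have : ∑ x ∈ W, μ x ≤ (W.filter fun x => μ x ≠ 0).card * K := by
      rw [← Finset.sum_filter_ne_zero, ← nsmul_eq_mul]
      exact Finset.sum_le_card_nsmul _ _ _ fun x _ => hμK x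
    have h2 := le_of_mul_le_mul_right ((hlamK.trans hW).trans this) hK
    obtain ⟨a, ha, haW⟩ := exists_isFibreTuple m r j (W.filter fun x => μ x ≠ 0) z
      (fun x hx => hμz x (Finset.mem_filter.1 hx).2) (by exact_mod_cast h2)
    exact ⟨a, ha, fun i => (Finset.mem_filter.1 (haW i)).1⟩
  have hinner : ∀ a : SizedSubset m r → Fin n → ZMod 2, IsFibreTuple j a →
      |∑ S, ∑ y, ν y * χ (a S + y)| ≤ (η + δ) * Fintype.card (SizedSubset m r) := by
    intro a ha
    -- Greedy removal is used twice: here on ν with the fibre tuple a fixed, and afterwards on μ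
    -- with this bound as the hypothesis on tuples.
    have := abs_sum_mul_le_of_tuples (good := IsSectionTuple j) (φ := fun y => ∑ S, χ (a S + y))
      (c := η * m.choose r) (M := m.choose r) (lam := δ) (fun b hb => hb.injective) (by positivity)
      (by positivity) (fun b hb => ?_) (fun y => ?_) ν hν0 hsec
    · rw [Finset.sum_comm]
      simp only [← Finset.mul_sum]
      refine this.trans ?_
      rw [hcard]
      have : η * m.choose r * ∑ y, ν y ≤ η * m.choose r * 1 := by gcongr
      linarith
    · rw [Finset.sum_comm, hcard, mul_assoc]
      exact hgrid a b ha hb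
    · refine (Finset.abs_sum_le_sum_abs _ _).trans ?_
      refine (Finset.sum_le_card_nsmul _ _ 1 fun S _ => hχ _).trans ?_
      rw [Finset.card_univ, card_sizedSubset]
      simp
  have := abs_sum_mul_le_of_tuples (good := IsFibreTuple j) (φ := fun x => ∑ y, ν y * χ (x + y))
    (c := η + δ) (M := 1) (lam := lam) (fun a ha => ha.injective) (by positivity) zero_le_one
    hinner (fun x => ?_) μ hμ0 hfib
  · simpa using this
  · refine (Finset.abs_sum_le_sum_abs _ _).trans (le_trans (Finset.sum_le_sum fun y _ => ?_) hν1)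
    rw [abs_mul, abs_of_nonneg (hν0 y)]
    exact mul_le_of_le_one_right (hν0 y) (hχ _)

/-- The part of the correlation sum coming from pairs of points with related levels. -/
theorem abs_sum_level_rel_le {n m r : ℕ} (hr : r ≤ m) {χ : (Fin n → ZMod 2) → ℝ}
    {η δ lam τ K : ℝ} (hχ : ∀ x, |χ x| ≤ 1) (hη : 0 ≤ η) (hδ : 0 ≤ δ) (hlam : 0 ≤ lam)
    (hτ0 : 0 < τ) (hK : 0 < K) (hKτ : K ≤ τ) (hτ1 : τ ≤ 1)
    (hgrid : ∀ j, ∀ a b : SizedSubset m r → Fin n → ZMod 2, IsFibreTuple j a → IsSectionTuple j b →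
      |∑ S, ∑ T, χ (a S + b T)| ≤ η * (m.choose r * m.choose r))
    {μ ν : (Fin n → ZMod 2) → ℝ} (hμ0 : ∀ x, 0 ≤ μ x) (hν0 : ∀ x, 0 ≤ ν x)
    (hμ1 : ∑ x, μ x = 1) (hν1 : ∑ x, ν x = 1) (hμK : ∀ x, μ x ≤ K) (hνK : ∀ x, ν x ≤ K)
    (hδτ : 2 ^ (2 * m) * (2 * τ) ≤ δ) (hlamK : 2 ^ (2 * m) * K ≤ lam)
    (hlamδ : (n + 1) * lam ≤ δ * τ) (R : ℕ → ℕ → Prop) [DecidableRel R]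
    (hR : ∀ i l, R i l → i ≤ l) :
    |∑ x, ∑ y, if R (level μ τ x) (level ν τ y) then μ x * (ν y * χ (x + y)) else 0| ≤
      η + 2 * δ := by
  classical
  let key : (Fin n → ZMod 2) → ℕ × (Fin n → ZMod 2) := fun x =>
    (level μ τ x, mask n (level μ τ x) x)
  rw [← Finset.sum_fiberwise_of_maps_to (s := Finset.univ) (t := Finset.univ.image key) (g := key)
    fun x hx => Finset.mem_image_of_mem key hx]
  have hcell : ∀ q ∈ Finset.univ.image key, |∑ x with key x = q, ∑ y,
      if R (level μ τ x) (level ν τ y) then μ x * (ν y * χ (x + y)) else 0| ≤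
      (η + δ) * ∑ x with key x = q, μ x + lam := by
    intro q _
    have := abs_sum_cell_le (j := q.1) (μ := fun x => if key x = q then μ x else 0)
      (ν := fun y => if R q.1 (level ν τ y) then ν y else 0) hr hχ hη hδ hτ0 hK (hgrid q.1)
      (fun x => by split_ifs <;> simp [hμ0]) (fun x => by split_ifs <;> simp [hν0])
      (fun x => by split_ifs <;> simp [hμK, hK.le]) q.2
      (fun x hx => by
        have hx' : key x = q := by
          by_contra h
          simp [h] at hx
        rw [← hx'])
      (by
        rw [← hν1]
        refine Finset.sum_le_sum fun y _ => ?_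
        split_ifs <;> simp [hν0])
      (fun z => by
        rw [← Finset.sum_filter, Finset.filter_filter]
        refine le_trans ?_ (sum_fibre_above_level_le hν0 hν1 hτ1 (fun x => (hνK x).trans hKτ) q.1 z)
        refine Finset.sum_le_sum_of_subset_of_nonneg ?_ fun _ _ _ => hν0 _
        intro y hy
        rw [Finset.mem_filter] at hy ⊢
        exact ⟨hy.1, hy.2.1, hR _ _ hy.2.2⟩) hδτ hlamK
    rw [Finset.sum_filter, Finset.sum_filter]
    convert this using 3
    rename_i x _
    by_cases hx : key x = q
    · rw [if_pos hx, if_pos hx, Finset.mul_sum]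
      refine Finset.sum_congr rfl fun y _ => ?_
      rw [← hx]
      change (if R (level μ τ x) (level ν τ y) then _ else _) =
        μ x * ((if R (level μ τ x) (level ν τ y) then _ else _) * _)
      split_ifs <;> simp
    · rw [if_neg hx, if_neg hx, zero_mul]
  refine (Finset.abs_sum_le_sum_abs _ _).trans ((Finset.sum_le_sum hcell).trans ?_)
  rw [Finset.sum_add_distrib, ← Finset.mul_sum, Finset.sum_fiberwise_of_maps_to
    fun x hx => Finset.mem_image_of_mem key hx, hμ1, Finset.sum_const, nsmul_eq_mul]
  have h1 : ((Finset.univ.image key).card : ℝ) * τ ≤ n + 1 := card_levelCells_mul_le hμ0 hμ1 hτ1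
  -- Each cell loses lam to its unremovable remainder; the bound on the number of cells keeps the
  -- total loss below δ.
  have h2 : ((Finset.univ.image key).card : ℝ) * lam ≤ δ := by
    refine le_of_mul_le_mul_right ?_ hτ0
    calc _ = ((Finset.univ.image key).card : ℝ) * τ * lam := by ring
      _ ≤ (n + 1) * lam := by gcongr
      _ ≤ _ := hlamδ
  linarith

/-- Split the pairs by which level is smaller: that point supplies the fibre tuples. Ties are
assigned to x, hence `≤` in one application and `<` in the other. -/
theorem abs_sum_sumset_le {n m r : ℕ} (hr : r ≤ m) {χ : (Fin n → ZMod 2) → ℝ}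
    {η δ lam τ K : ℝ} (hχ : ∀ x, |χ x| ≤ 1) (hη : 0 ≤ η) (hδ : 0 ≤ δ) (hlam : 0 ≤ lam)
    (hτ0 : 0 < τ) (hK : 0 < K) (hKτ : K ≤ τ) (hτ1 : τ ≤ 1)
    (hgrid : ∀ j, ∀ a b : SizedSubset m r → Fin n → ZMod 2, IsFibreTuple j a → IsSectionTuple j b →
      |∑ S, ∑ T, χ (a S + b T)| ≤ η * (m.choose r * m.choose r))
    {μ ν : (Fin n → ZMod 2) → ℝ} (hμ0 : ∀ x, 0 ≤ μ x) (hν0 : ∀ x, 0 ≤ ν x)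
    (hμ1 : ∑ x, μ x = 1) (hν1 : ∑ x, ν x = 1) (hμK : ∀ x, μ x ≤ K) (hνK : ∀ x, ν x ≤ K)
    (hδτ : 2 ^ (2 * m) * (2 * τ) ≤ δ) (hlamK : 2 ^ (2 * m) * K ≤ lam)
    (hlamδ : (n + 1) * lam ≤ δ * τ) :
    |∑ x, ∑ y, μ x * (ν y * χ (x + y))| ≤ 2 * η + 4 * δ := by
  have h1 := abs_sum_level_rel_le hr hχ hη hδ hlam hτ0 hK hKτ hτ1 hgrid hμ0 hν0 hμ1 hν1 hμK hνK
    hδτ hlamK hlamδ (· ≤ ·) fun _ _ h => h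
  have h2 := abs_sum_level_rel_le hr hχ hη hδ hlam hτ0 hK hKτ hτ1 hgrid hν0 hμ0 hν1 hμ1 hνK hμK
    hδτ hlamK hlamδ (· < ·) fun _ _ h => h.le
  rw [Finset.sum_comm] at h2
  have h3 : ∑ x, ∑ y, μ x * (ν y * χ (x + y)) =
      (∑ x, ∑ y, if level μ τ x ≤ level ν τ y then μ x * (ν y * χ (x + y)) else 0) +
      ∑ x, ∑ y, if level ν τ y < level μ τ x then ν y * (μ x * χ (y + x)) else 0 := by
    simp only [← Finset.sum_add_distrib]
    refine Finset.sum_congr rfl fun x _ => Finset.sum_congr rfl fun y _ => ?_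
    rcases le_or_gt (level μ τ x) (level ν τ y) with h | h
    · rw [if_pos h, if_neg (not_lt.2 h), add_zero]
    · rw [if_neg (not_le.2 h), if_pos h, zero_add, add_comm y x]
      ring
  rw [h3]
  exact (abs_add_le _ _).trans (by linarith)

/-! ### Estimates for binomial coefficients with real argument. -/

theorem factorial_mul_choose_eq_prod (x : ℝ) (q : ℕ) :
    (q.factorial : ℝ) * Ring.choose x q = ∏ i ∈ Finset.range q, (x - i) := by
  rw [← descPochhammer_eval_eq_prod_range, ← nsmul_eq_mul,
    ← Ring.descPochhammer_eq_factorial_smul_choose, ← Polynomial.aeval_eq_smeval,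
    ← descPochhammer_map (Int.castRingHom ℝ), Polynomial.eval_map, Polynomial.aeval_def]
  rfl

theorem factorial_eq_prod_sub (q : ℕ) : (q.factorial : ℝ) = ∏ i ∈ Finset.range q, ((q : ℝ) - i) := by
  rw [← factorial_mul_choose_eq_prod, Ring.choose_natCast, Nat.choose_self, Nat.cast_one, mul_one]

theorem div_pow_le_choose {x : ℝ} {q : ℕ} (h : (q : ℝ) ≤ x) : (x / q) ^ q ≤ Ring.choose x q := by
  have hpos : (0 : ℝ) < q.factorial := by exact_mod_cast q.factorial_pos
  refine le_of_mul_le_mul_left ?_ hpos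
  rw [factorial_mul_choose_eq_prod, factorial_eq_prod_sub]
  conv_lhs => rw [← Finset.card_range q, ← Finset.prod_const, Finset.card_range,
    ← Finset.prod_mul_distrib]
  refine Finset.prod_le_prod (fun i hi => ?_) fun i hi => ?_
  all_goals
    have hi' : (i : ℝ) < q := by exact_mod_cast Finset.mem_range.1 hi
    have hi0 : (0 : ℝ) ≤ i := Nat.cast_nonneg i
  · exact mul_nonneg (by linarith) (div_nonneg (by linarith) (by linarith))
  · have hq : (0 : ℝ) < q := by linarith
    rw [mul_div_assoc', div_le_iff₀ hq]
    nlinarith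

/-- Factor by factor, x - i ≤ c (y - i), since c ≤ 1. -/
theorem choose_le_pow_mul_choose {x y c : ℝ} {q : ℕ} (hx : (q : ℝ) ≤ x) (hc1 : c ≤ 1)
    (hxy : x ≤ c * y) : Ring.choose x q ≤ c ^ q * Ring.choose y q := by
  have hpos : (0 : ℝ) < q.factorial := by exact_mod_cast q.factorial_pos
  refine le_of_mul_le_mul_left ?_ hpos
  rw [mul_left_comm, factorial_mul_choose_eq_prod, factorial_mul_choose_eq_prod]
  conv_rhs => rw [← Finset.card_range q, ← Finset.prod_const, Finset.card_range,
    ← Finset.prod_mul_distrib]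
  refine Finset.prod_le_prod (fun i hi => ?_) fun i hi => ?_
  all_goals
    have hi' : (i : ℝ) < q := by exact_mod_cast Finset.mem_range.1 hi
    have hi0 : (0 : ℝ) ≤ i := Nat.cast_nonneg i
  · linarith
  · nlinarith

/-- Splitting a 2r-set into two r-sets counts it at least once among ordered pairs of r-sets. -/
theorem choose_two_mul_le_sq (m r : ℕ) : m.choose (2 * r) ≤ m.choose r * m.choose r := by
  rcases le_or_gt (2 * r) m with h | h
  · have h1 := Nat.choose_mul (n := m) (by omega : r ≤ 2 * r)
    have h2 : 1 ≤ (2 * r).choose r := Nat.choose_pos (by omega)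
    have h3 : (m - r).choose (2 * r - r) ≤ m.choose r := by
      rw [show 2 * r - r = r by omega]
      exact Nat.choose_le_choose r (Nat.sub_le m r)
    calc m.choose (2 * r) ≤ m.choose (2 * r) * (2 * r).choose r := Nat.le_mul_of_pos_right _ h2
      _ = _ := h1
      _ ≤ _ := Nat.mul_le_mul_left _ h3
  · rw [Nat.choose_eq_zero_of_lt h]
    exact Nat.zero_le _

/-! ### Min-entropy, statistical distance and counting coefficient vectors. -/

theorem toReal_le_of_le_minEntropy {α : Type*} [Finite α] {X : PMF α} {k : ℕ}
    (h : (k : ℝ) ≤ minEntropy X) (x : α) : (X x).toReal ≤ ((2 : ℝ) ^ k)⁻¹ := by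
  by_cases hx : X x = 0
  · rw [hx, ENNReal.toReal_zero]
    positivity
  · have hpos : 0 < (X x).toReal := ENNReal.toReal_pos hx (X.apply_ne_top x)
    have h1 : (k : ℝ) ≤ Real.logb 2 (1 / (X x).toReal) :=
      h.trans (ciInf_le (Set.finite_range _).bddBelow (⟨x, hx⟩ : X.support))
    rw [Real.le_logb_iff_rpow_le one_lt_two (by positivity), Real.rpow_natCast] at h1
    rw [le_inv_comm₀ hpos (by positivity), ← one_div]
    exact h1

theorem sum_toReal_eq_one {α : Type*} [Fintype α] (X : PMF α) : ∑ x, (X x).toReal = 1 := by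
  rw [← ENNReal.toReal_sum fun x _ => X.apply_ne_top x,
    show ∑ x, X x = 1 from (tsum_fintype _).symm.trans X.tsum_coe, ENNReal.toReal_one]

theorem toReal_map_sumLaw {α β : Type*} [Fintype α] [Add α] [DecidableEq β] (A B : PMF α) (f : α → β)
    (c : β) : ((sumLaw A B).map f c).toReal =
      ∑ x, ∑ y, (A x).toReal * if f (x + y) = c then (B y).toReal else 0 := by
  have h : (sumLaw A B).map f = A.bind fun a => B.map fun b => f (a + b) := by
    rw [sumLaw, PMF.map_bind]
    simp only [PMF.map_comp]
    rfl
  rw [h, PMF.bind_apply, tsum_fintype, ENNReal.toReal_sum fun x _ =>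
    ENNReal.mul_ne_top (A.apply_ne_top x) (PMF.apply_ne_top _ _)]
  refine Finset.sum_congr rfl fun x _ => ?_
  rw [ENNReal.toReal_mul, PMF.map_apply, tsum_fintype, ENNReal.toReal_sum, Finset.mul_sum]
  · refine Finset.sum_congr rfl fun y _ => ?_
    by_cases hc : f (x + y) = c
    · rw [if_pos hc, if_pos hc.symm]
    · rw [if_neg hc, if_neg (Ne.symm hc), ENNReal.toReal_zero]
  · intro y _
    split_ifs
    · exact B.apply_ne_top y
    · exact ENNReal.zero_ne_top

theorem statDist_uniform_bit (X : PMF (ZMod 2)) :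
    statDist X (PMF.uniformOfFintype (ZMod 2)) = |(X 0).toReal - (X 1).toReal| / 2 := by
  have h := sum_toReal_eq_one X
  rw [ZMod.sum_univ_two] at h
  rw [statDist, ZMod.sum_univ_two]
  simp only [PMF.uniformOfFintype_apply, ZMod.card, ENNReal.toReal_inv]
  have h2 : ((2 : ℕ) : ENNReal).toReal = 2 := by simp
  rw [h2]
  have h3 : (X 0).toReal - 2⁻¹ = ((X 0).toReal - (X 1).toReal) / 2 := by linarith
  have h4 : (X 1).toReal - 2⁻¹ = -(((X 0).toReal - (X 1).toReal) / 2) := by linarith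
  rw [h3, h4, abs_neg, abs_div, abs_two]
  ring

theorem statDist_map_sumLaw {n : ℕ} (A B : PMF (Fin n → ZMod 2)) (f : (Fin n → ZMod 2) → ZMod 2) :
    statDist ((sumLaw A B).map f) (PMF.uniformOfFintype (ZMod 2)) =
      |∑ x, ∑ y, (A x).toReal * ((B y).toReal * sgn (f (x + y)))| / 2 := by
  rw [statDist_uniform_bit, toReal_map_sumLaw, toReal_map_sumLaw]
  simp only [← Finset.sum_sub_distrib]
  congr 2
  refine Finset.sum_congr rfl fun x _ => Finset.sum_congr rfl fun y _ => ?_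
  by_cases h : f (x + y) = 0
  · simp [h, sgn]
  · have h1 := ZMod.two_ne_zero_iff.1 h
    simp [h1, sgn]

theorem le_extractorProb_of_card_le {n k d : ℕ} {ε q : ℝ}
    (h : (Nat.card {α : Coeffs n d // ¬ IsExtractor (sumsetSources n k) ε (polyFun α)} : ℝ) ≤
      Fintype.card (Coeffs n d) * q) : 1 - q ≤ extractorProb n k d ε := by
  classical
  rw [extractorProb, randomPoly, PMF.toOuterMeasure_map_apply,
    PMF.toOuterMeasure_uniformOfFintype_apply, ENNReal.toReal_div, ENNReal.toReal_natCast,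
    ENNReal.toReal_natCast]
  have hpos : (0 : ℝ) < Fintype.card (Coeffs n d) := by exact_mod_cast Fintype.card_pos
  rw [le_div_iff₀ hpos]
  rw [Nat.card_eq_fintype_card, Fintype.card_subtype_compl,
    Nat.cast_sub (Fintype.card_subtype_le _)] at h
  have h2 : Fintype.card {α : Coeffs n d // IsExtractor (sumsetSources n k) ε (polyFun α)} =
      Fintype.card ↑(polyFun (d := d) ⁻¹' {f | IsExtractor (sumsetSources n k) ε f}) :=
    Fintype.card_congr (Equiv.refl _)
  rw [h2] at h
  linarith

theorem isExtractor_of_half_le {n : ℕ} {ε : ℝ} (hε : 1 / 2 ≤ ε) (𝒳 : Set (PMF (Fin n → ZMod 2)))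
    (f : (Fin n → ZMod 2) → ZMod 2) : IsExtractor 𝒳 ε f := by
  intro X _
  rw [statDist_uniform_bit]
  have h := sum_toReal_eq_one (X.map f)
  rw [ZMod.sum_univ_two] at h
  have h0 : 0 ≤ (X.map f 0).toReal := ENNReal.toReal_nonneg
  have h1 : 0 ≤ (X.map f 1).toReal := ENNReal.toReal_nonneg
  have : |(X.map f 0).toReal - (X.map f 1).toReal| ≤ 1 := abs_le.2 ⟨by linarith, by linarith⟩
  linarith

/-! ### Union bound and reduction of extraction to grids. -/

/-- Union bound over all independent grids. -/
theorem card_exists_biased_le (n d : ℕ) (ι : Type*) [Fintype ι] {η : ℝ} (hη : 0 ≤ η) :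
    (Nat.card {α : Coeffs n d // ∃ a b : ι → Fin n → ZMod 2, IndependentGrid d a b ∧
      η * (Fintype.card ι * Fintype.card ι) < |∑ i, ∑ l, sgn (polyFun α (a i + b l))|} : ℝ) ≤
      Fintype.card (Coeffs n d) * (2 ^ (2 * n * Fintype.card ι) *
        (2 * Real.exp (-(η ^ 2 * (Fintype.card ι * Fintype.card ι) / 2)))) := by
  classical
  let bad : (ι → Fin n → ZMod 2) × (ι → Fin n → ZMod 2) → Finset (Coeffs n d) := fun q =>
    Finset.univ.filter fun α => IndependentGrid d q.1 q.2 ∧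
      η * (Fintype.card ι * Fintype.card ι) < |∑ i, ∑ l, sgn (polyFun α (q.1 i + q.2 l))|
  have hbad : ∀ q, ((bad q).card : ℝ) ≤ Fintype.card (Coeffs n d) *
      (2 * Real.exp (-(η ^ 2 * (Fintype.card ι * Fintype.card ι) / 2))) := by
    intro q
    by_cases hq : IndependentGrid d q.1 q.2
    · simp only [bad, hq, true_and]
      exact card_biased_le hq hη
    · simp only [bad, hq, false_and, Finset.filter_false, Finset.card_empty, Nat.cast_zero]
      positivity
  have h1 : Nat.card {α : Coeffs n d // ∃ a b : ι → Fin n → ZMod 2, IndependentGrid d a b ∧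
      η * (Fintype.card ι * Fintype.card ι) < |∑ i, ∑ l, sgn (polyFun α (a i + b l))|} ≤
      ∑ q, (bad q).card := by
    rw [Nat.card_eq_fintype_card, Fintype.card_subtype]
    refine le_trans (Finset.card_le_card ?_) Finset.card_biUnion_le
    intro α hα
    obtain ⟨a, b, h⟩ := (Finset.mem_filter.1 hα).2
    exact Finset.mem_biUnion.2 ⟨(a, b), Finset.mem_univ _, Finset.mem_filter.2 ⟨Finset.mem_univ _, h⟩⟩
  calc _ ≤ ((∑ q, (bad q).card : ℕ) : ℝ) := by exact_mod_cast h1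
    _ = ∑ q, ((bad q).card : ℝ) := by push_cast; rfl
    _ ≤ _ := Finset.sum_le_card_nsmul _ _ _ fun q _ => hbad q
    _ = _ := by
      rw [Finset.card_univ, Fintype.card_prod, Fintype.card_fun, Fintype.card_fun, ZMod.card,
        Fintype.card_fin, nsmul_eq_mul]
      push_cast
      rw [← pow_mul, ← pow_add, show n * Fintype.card ι + n * Fintype.card ι =
        2 * n * Fintype.card ι by ring]
      ring

/-- A polynomial with small bias on all independent grids is an extractor for sumset sources. -/
theorem isExtractor_of_grids {n k d m r : ℕ} {ε : ℝ} (hε : 0 < ε) (hr : r ≤ m) (hd : 2 * r ≤ d)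
    (hk : 8 * m ≤ k) (hn : 1 ≤ n) (hm : 4 * (n + 1) ≤ ε * 2 ^ (2 * m))
    (f : (Fin n → ZMod 2) → ZMod 2)
    (hf : ∀ a b : SizedSubset m r → Fin n → ZMod 2, IndependentGrid d a b →
      |∑ i, ∑ l, sgn (f (a i + b l))| ≤ ε / 2 * (m.choose r * m.choose r)) :
    IsExtractor (sumsetSources n k) ε f := by
  rintro _ ⟨A, B, hA, hB, rfl⟩
  rw [statDist_map_sumLaw]
  have hn' : (1 : ℝ) ≤ n := by exact_mod_cast hn
  have hN1 : (1 : ℝ) ≤ 2 ^ (2 * m) := one_le_pow₀ one_le_two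
  have hKk : ((2 : ℝ) ^ k)⁻¹ ≤ ((2 ^ (2 * m)) ^ 4)⁻¹ := by
    rw [← pow_mul]
    exact inv_anti₀ (by positivity) (pow_le_pow_right₀ one_le_two (by omega))
  set N : ℝ := 2 ^ (2 * m) with hN
  have hN0 : 0 < N := by linarith
  -- With these values 2η + 4δ = 2ε, and the statistical distance is half of it. Point masses are at
  -- most N⁻⁴ because 8m ≤ k; lam is the largest value for which the losses of all cells sum to at
  -- most δ.
  have hmain := abs_sum_sumset_le (n := n) hr (χ := fun x => sgn (f x)) (η := ε / 2) (δ := ε / 4)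
    (lam := ε / 4 * (N ^ 2)⁻¹ / (n + 1)) (τ := (N ^ 2)⁻¹) (K := (N ^ 4)⁻¹)
    (μ := fun x => (A x).toReal) (ν := fun x => (B x).toReal)
    (fun x => (abs_sgn _).le) (by positivity) (by positivity) (by positivity) (by positivity)
    (by positivity) (inv_anti₀ (by positivity) (pow_le_pow_right₀ hN1 (by norm_num)))
    (inv_le_one_of_one_le₀ (one_le_pow₀ hN1))
    (fun j a b ha hb => hf a b (ha.independentGrid hd hb))
    (fun _ => ENNReal.toReal_nonneg) (fun _ => ENNReal.toReal_nonneg)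
    (sum_toReal_eq_one A) (sum_toReal_eq_one B)
    (fun x => (toReal_le_of_le_minEntropy hA x).trans hKk)
    (fun x => (toReal_le_of_le_minEntropy hB x).trans hKk) ?_ ?_ ?_
  · linarith
  · rw [← hN, show N * (2 * (N ^ 2)⁻¹) = 2 / N by field_simp, div_le_iff₀ hN0]
    linarith
  · rw [← hN, le_div_iff₀ (by positivity), show N * (N ^ 4)⁻¹ * (n + 1) =
      ((n : ℝ) + 1) / N * (N ^ 2)⁻¹ by field_simp]
    refine mul_le_mul_of_nonneg_right ?_ (by positivity)
    rw [div_le_iff₀ hN0]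
    linarith
  · rw [mul_div_cancel₀ _ (by positivity)]

/-! ### Choice of parameters. -/

theorem rpow_one_div_pow {y : ℝ} (hy : 0 ≤ y) {r : ℕ} (hr : r ≠ 0) :
    (y ^ ((1 : ℝ) / (r : ℝ))) ^ r = y := by
  rw [one_div, Real.rpow_inv_natCast_pow hy hr]

theorem sq_div_sq_le_sq_mul_choose {n r : ℕ} {ε x : ℝ} (hr : 1 ≤ r) (hε : 0 < ε)
    (hεn : ε ^ 2 ≤ n) (hx : 2 * r * ((n : ℝ) / ε ^ 2) ^ ((1 : ℝ) / (r : ℝ)) ≤ x) :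
    (n : ℝ) ^ 2 / ε ^ 2 ≤ ε ^ 2 * Ring.choose x (2 * r) := by
  have hy : 1 ≤ (n : ℝ) / ε ^ 2 := (one_le_div (by positivity)).2 hεn
  have hw : 1 ≤ ((n : ℝ) / ε ^ 2) ^ ((1 : ℝ) / (r : ℝ)) := Real.one_le_rpow hy (by positivity)
  have hwr := rpow_one_div_pow (zero_le_one.trans hy) (by omega : r ≠ 0)
  set w := ((n : ℝ) / ε ^ 2) ^ ((1 : ℝ) / (r : ℝ))
  have hr' : (1 : ℝ) ≤ r := by exact_mod_cast hr
  have h1 : ((2 * r : ℕ) : ℝ) ≤ x := by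
    push_cast
    nlinarith
  have h2 : w ≤ x / (2 * r : ℕ) := by
    rw [le_div_iff₀ (by positivity)]
    push_cast
    linarith
  have h3 : ((n : ℝ) / ε ^ 2) ^ 2 ≤ Ring.choose x (2 * r) := by
    calc ((n : ℝ) / ε ^ 2) ^ 2 = w ^ (2 * r) := by rw [← hwr, ← pow_mul, mul_comm]
      _ ≤ (x / (2 * r : ℕ)) ^ (2 * r) := by gcongr
      _ ≤ _ := div_pow_le_choose h1
  calc (n : ℝ) ^ 2 / ε ^ 2 = ε ^ 2 * ((n : ℝ) / ε ^ 2) ^ 2 := by field_simp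
    _ ≤ _ := by gcongr

theorem extractorProb_of_half_le {n k d : ℕ} {ε q : ℝ} (hε : 1 / 2 ≤ ε) (hq : 0 ≤ q) :
    1 - q ≤ extractorProb n k d ε := by
  apply le_extractorProb_of_card_le
  have : IsEmpty {α : Coeffs n d // ¬ IsExtractor (sumsetSources n k) ε (polyFun α)} :=
    ⟨fun α => α.2 (isExtractor_of_half_le hε _ _)⟩
  rw [Nat.card_of_isEmpty, Nat.cast_zero]
  positivity

/-- Failure probability of a random polynomial in terms of the size of the independent grids. -/
theorem one_sub_le_extractorProb_of_grid {n k d m r : ℕ} {ε X : ℝ} (hε : 0 < ε) (hr : r ≤ m)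
    (hd : 2 * r ≤ d) (hk : 8 * m ≤ k) (hn : 1 ≤ n) (hm : 4 * (n + 1) ≤ ε * 2 ^ (2 * m))
    (ht : 48 * n ≤ ε ^ 2 * m.choose r) (hX : 16 * X ≤ m.choose r * m.choose r) :
    1 - (2 : ℝ) ^ (-(ε ^ 2 * X)) ≤ extractorProb n k d ε := by
  apply le_extractorProb_of_card_le
  have h1 := card_exists_biased_le n d (SizedSubset m r) (η := ε / 2) (by positivity)
  rw [card_sizedSubset] at h1
  have hle : Nat.card {α : Coeffs n d // ¬ IsExtractor (sumsetSources n k) ε (polyFun α)} ≤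
      Nat.card {α : Coeffs n d // ∃ a b : SizedSubset m r → Fin n → ZMod 2, IndependentGrid d a b ∧
        ε / 2 * (m.choose r * m.choose r) < |∑ i, ∑ l, sgn (polyFun α (a i + b l))|} := by
    refine Nat.card_le_card_of_injective (Subtype.map id fun α hα => ?_)
      (Subtype.map_injective _ Function.injective_id)
    by_contra! hcon
    exact hα (isExtractor_of_grids hε hr hd hk hn hm _ hcon)
  refine (Nat.cast_le.2 hle).trans (h1.trans ?_)
  refine mul_le_mul_of_nonneg_left ?_ (Nat.cast_nonneg _)
  have ht1 : (1 : ℝ) ≤ m.choose r := by exact_mod_cast Nat.choose_pos hr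
  have hn' : (1 : ℝ) ≤ n := by exact_mod_cast hn
  set t : ℝ := (m.choose r : ℝ)
  have hexp : Real.exp (-((ε / 2) ^ 2 * (t * t) / 2)) ≤ (2 : ℝ) ^ (-((ε / 2) ^ 2 * (t * t) / 2)) := by
    rw [Real.exp_neg, Real.rpow_neg zero_le_two, ← Real.exp_one_rpow]
    refine inv_anti₀ (by positivity) (Real.rpow_le_rpow zero_le_two ?_ (by positivity))
    exact (by norm_num : (2 : ℝ) ≤ 1 + 1).trans (Real.add_one_le_exp 1)
  calc (2 : ℝ) ^ (2 * n * m.choose r) * (2 * Real.exp (-((ε / 2) ^ 2 * (t * t) / 2)))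
      ≤ (2 : ℝ) ^ (2 * n * m.choose r) * (2 * (2 : ℝ) ^ (-((ε / 2) ^ 2 * (t * t) / 2))) := by gcongr
    _ = (2 : ℝ) ^ (2 * n * t + 1 + -((ε / 2) ^ 2 * (t * t) / 2)) := by
        rw [Real.rpow_add two_pos, Real.rpow_add two_pos, Real.rpow_one, ← Real.rpow_natCast]
        push_cast
        ring
    _ ≤ _ := by
        refine Real.rpow_le_rpow_of_exponent_le one_le_two ?_
        have h2 : 48 * n * t ≤ ε ^ 2 * t * t := by gcongr
        have h3 : 1 ≤ (n : ℝ) * t := one_le_mul_of_one_le_of_one_le hn' ht1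
        have h4 : ε ^ 2 * (16 * X) ≤ ε ^ 2 * (t * t) := by gcongr
        -- Since 2nt + 1 ≤ 3nt ≤ ε²t²/16, half of the exponent ε²t²/8 pays for the union bound, and
        -- the other half dominates ε²X.
        nlinarith

theorem one_sub_le_extractorProb {n k d : ℕ} {ε : ℝ} (hdk : d ≤ k) (hkn : k ≤ n) (hd : 2 ≤ d)
    (hε : 0 < ε)
    (hC : 512 * (d : ℝ) * ((n : ℝ) / ε ^ 2) ^ ((1 : ℝ) / ((d / 2 : ℕ) : ℝ)) ≤ (k : ℝ)) :
    1 - (2 : ℝ) ^ (-(ε ^ 2 * Ring.choose ((k : ℝ) / 512) (2 * (d / 2)))) ≤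
      extractorProb n k d ε := by
  -- A bit is never farther than 1/2 from uniform.
  rcases le_or_gt (1 / 2) ε with hε2 | hε2
  · exact extractorProb_of_half_le hε2 (by positivity)
  have hr1 : 1 ≤ d / 2 := by omega
  have hrd : 2 * (d / 2) ≤ d := by omega
  have hn : (1 : ℝ) ≤ n := by exact_mod_cast (by omega : 1 ≤ n)
  generalize d / 2 = r at *
  have hr1' : (1 : ℝ) ≤ r := by exact_mod_cast hr1
  have hrd' : 2 * (r : ℝ) ≤ d := by exact_mod_cast hrd
  have hεsq : ε ^ 2 ≤ ε / 2 := by nlinarith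
  have hy : 1 ≤ (n : ℝ) / ε ^ 2 := (one_le_div (by positivity)).2 (by linarith)
  have hw : 1 ≤ ((n : ℝ) / ε ^ 2) ^ ((1 : ℝ) / (r : ℝ)) := Real.one_le_rpow hy (by positivity)
  have hwr := rpow_one_div_pow (zero_le_one.trans hy) (by omega : r ≠ 0)
  set w := ((n : ℝ) / ε ^ 2) ^ ((1 : ℝ) / (r : ℝ))
  have hk : 1024 * (r * w) ≤ (k : ℝ) := by
    have : 2 * (r : ℝ) * w ≤ d * w := by gcongr
    linarith
  have hrw : (r : ℝ) ≤ r * w := le_mul_of_one_le_right (by linarith) hw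
  have hm16 : (k : ℝ) ≤ 16 * (k / 8 : ℕ) := by
    have : (1024 : ℝ) ≤ k := by linarith
    have : 1024 ≤ k := by exact_mod_cast this
    exact_mod_cast (by omega : k ≤ 16 * (k / 8))
  have hmk : 8 * (k / 8) ≤ k := by omega
  -- The grids use m = ⌊k/8⌋, of which only 8m ≤ k ≤ 16m is needed.
  generalize k / 8 = m at *
  have hmw : 64 * (r * w) ≤ (m : ℝ) := by linarith
  have hrm : r ≤ m := by
    have : (r : ℝ) ≤ m := by linarith
    exact_mod_cast this
  refine one_sub_le_extractorProb_of_grid hε hrm hrd hmk (by omega) ?_ ?_ ?_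
  · have h1 : 4 * ((n : ℝ) / ε ^ 2) ≤ 2 ^ (2 * m) := by
      have hb : 4 * w ≤ (2 : ℝ) ^ (4 * w) := by
        have := one_add_mul_self_le_rpow_one_add (s := 1) (by norm_num) (p := 4 * w) (by linarith)
        norm_num at this
        linarith
      calc 4 * ((n : ℝ) / ε ^ 2) = 4 * w ^ r := by rw [hwr]
        _ ≤ 4 ^ r * w ^ r := by
          gcongr
          exact le_self_pow₀ (by norm_num) (by omega)
        _ = (4 * w) ^ r := (mul_pow _ _ _).symm
        _ ≤ ((2 : ℝ) ^ (4 * w)) ^ r := by gcongr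
        _ = (2 : ℝ) ^ (4 * w * r) := (Real.rpow_mul_natCast zero_le_two _ _).symm
        _ ≤ (2 : ℝ) ^ ((2 * m : ℕ) : ℝ) := by
          refine Real.rpow_le_rpow_of_exponent_le one_le_two ?_
          push_cast
          linarith
        _ = _ := Real.rpow_natCast _ _
    have h2 : ε * (4 * ((n : ℝ) / ε ^ 2)) = 4 * n / ε := by field_simp
    have h3 : 4 * ((n : ℝ) + 1) ≤ 4 * n / ε := by
      rw [le_div_iff₀ hε]
      nlinarith
    calc 4 * ((n : ℝ) + 1) ≤ ε * (4 * ((n : ℝ) / ε ^ 2)) := by rw [h2]; exact h3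
      _ ≤ _ := by gcongr
  · have h1 : (m / r : ℝ) ^ r ≤ (m.choose r : ℝ) := by
      rw [← Ring.choose_natCast]
      exact div_pow_le_choose (by exact_mod_cast hrm)
    have h2 : 64 * w ≤ (m / r : ℝ) := by
      rw [le_div_iff₀ (by linarith)]
      linarith
    have h3 : 64 * ((n : ℝ) / ε ^ 2) ≤ m.choose r := by
      calc 64 * ((n : ℝ) / ε ^ 2) = 64 * w ^ r := by rw [hwr]
        _ ≤ 64 ^ r * w ^ r := by
          gcongr
          exact le_self_pow₀ (by norm_num) (by omega)
        _ = (64 * w) ^ r := (mul_pow _ _ _).symm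
        _ ≤ (m / r : ℝ) ^ r := by gcongr
        _ ≤ _ := h1
    rw [mul_div_assoc', div_le_iff₀ (by positivity)] at h3
    linarith
  -- Here k/512 ≤ m/32, so passing from k/512 to m gains 32^(-2r) ≤ 1/32, more than the required
  -- factor 1/16.
  · have h1 : Ring.choose ((k : ℝ) / 512) (2 * r) ≤
        (1 / 32) ^ (2 * r) * Ring.choose (m : ℝ) (2 * r) := by
      refine choose_le_pow_mul_choose ?_ (by norm_num) (by linarith)
      push_cast
      linarith
    rw [Ring.choose_natCast] at h1
    have h2 : ((1 : ℝ) / 32) ^ (2 * r) ≤ 1 / 32 :=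
      pow_le_of_le_one (by norm_num) (by norm_num) (by omega)
    have h3 : (m.choose (2 * r) : ℝ) ≤ m.choose r * m.choose r := by
      exact_mod_cast choose_two_mul_le_sq m r
    have h4 : ((1 : ℝ) / 32) ^ (2 * r) * m.choose (2 * r) ≤
        1 / 32 * (m.choose r * m.choose r) := by gcongr
    have h5 : (0 : ℝ) ≤ m.choose r * m.choose r := by positivity
    linarith

theorem mainTheorem1 :
    ∃ C : ℝ, 0 < C ∧
      ∀ (n k d : ℕ) (ε : ℝ), k ≤ n → d ≤ k → 2 ≤ d → 0 < ε →
        C * (d : ℝ) * ((n : ℝ) / ε ^ 2) ^ ((1 : ℝ) / ((d / 2 : ℕ) : ℝ)) ≤ (k : ℝ) →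
          1 - (2 : ℝ) ^ (-(ε ^ 2 * Ring.choose ((k : ℝ) / C) (2 * (d / 2)))) ≤
              extractorProb n k d ε ∧
          1 - (2 : ℝ) ^ (-((n : ℝ) ^ 2 / ε ^ 2)) ≤ extractorProb n k d ε ∧
          (ε ^ 2 ≤ (n : ℝ) →
            1 - (2 : ℝ) ^ (-((n : ℝ) ^ 2 / ε ^ 2)) ≤
              1 - (2 : ℝ) ^ (-(ε ^ 2 * Ring.choose ((k : ℝ) / C) (2 * (d / 2))))) := by
  refine ⟨512, by norm_num, fun n k d ε hkn hdk hd hε hC => ?_⟩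
  have h1 := one_sub_le_extractorProb hdk hkn hd hε hC
  have h3 : ε ^ 2 ≤ (n : ℝ) → 1 - (2 : ℝ) ^ (-((n : ℝ) ^ 2 / ε ^ 2)) ≤
      1 - (2 : ℝ) ^ (-(ε ^ 2 * Ring.choose ((k : ℝ) / 512) (2 * (d / 2)))) := by
    intro hεn
    refine sub_le_sub_left (Real.rpow_le_rpow_of_exponent_le one_le_two (neg_le_neg ?_)) 1
    refine sq_div_sq_le_sq_mul_choose (by omega) hε hεn ?_
    have hrd : 2 * ((d / 2 : ℕ) : ℝ) ≤ d := by exact_mod_cast (by omega : 2 * (d / 2) ≤ d)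
    rw [le_div_iff₀ (by norm_num)]
    have : 2 * ((d / 2 : ℕ) : ℝ) * ((n : ℝ) / ε ^ 2) ^ ((1 : ℝ) / ((d / 2 : ℕ) : ℝ)) ≤
        d * ((n : ℝ) / ε ^ 2) ^ ((1 : ℝ) / ((d / 2 : ℕ) : ℝ)) := by gcongr
    linarith
  refine ⟨h1, ?_, h3⟩
  rcases le_or_gt (ε ^ 2) n with hεn | hεn
  · exact (h3 hεn).trans h1
  -- Here ε² > n ≥ 1, so ε ≥ 1/2 and every function is an extractor.
  · have hn : (1 : ℝ) ≤ n := by exact_mod_cast (by omega : 1 ≤ n)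
    exact extractorProb_of_half_le (by nlinarith) (by positivity)
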